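/- Let $\mathbb F^n=\{0,1\}^n$ with the Hamming distance $d$. For a nonempty $C\subseteq\mathbb F^n$ and $X\subseteq\mathbb F^n$, let $I_r(C;X)$ be the set of all $c\in C$ with $d(c,x)\le r$ for at least one $x\in X$. The code $C$ is called $(r,\le\ell)$-identifying if $I_r(C;X)\ne I_r(C;Y)$ for all distinct $X,Y\subseteq\mathbb F^n$ with $|X|\le\ell$ and $|Y|\le\ell$ (the empty set is allowed). Let $M_r^{(\le\ell)}(n)$ denote the smallest cardinality of an $(r,\le\ell)$-identifying code in $\mathbb F^n$, and let $h(x)=-x\log_2x-(1-x)\log_2(1-x)$, with $0\log_2 0=0$, be the binary entropy function. **Theorem.** Let $\ell\ge1$ be a fixed integer, let $\rho\in[0,1/2)$, and let $r=r(n)$ be non-negative integers such that $r(n)/n\to\rho$ as $n\to\infty$. Then $(r(n),\le\ell)$-identifying codes in $\mathbb F^n$ exist for all sufficiently large $n$, and $$\lim_{n\to\infty}\frac1n\log_2 M_{r(n)}^{(\le\ell)}(n)=1-h(\rho).$$ -/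

import Mathlib

open Filter Topology

namespace HammingCode

/-- The binary Hamming space of dimension `n`. -/
abbrev Word (n : ℕ) : Type := Fin n → ZMod 2

/-- The Hamming ball of radius `r` centred at `x`. -/
def ball {n : ℕ} (r : ℕ) (x : Word n) : Finset (Word n) :=
  Finset.univ.filter fun y => hammingDist x y ≤ r

/-- The `r`-neighbourhood of a set `X` of words: the union of the balls centred at its elements. -/
def nbhd {n : ℕ} (r : ℕ) (X : Finset (Word n)) : Finset (Word n) :=
  X.biUnion (ball r)

/-- The set of codewords of `C` within distance `r` of at least one word in `X`. -/
def codeNbhd {n : ℕ} (r : ℕ) (C X : Finset (Word n)) : Finset (Word n) :=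
  nbhd r X ∩ C

/-- `C` is an `(r, ≤ ℓ)`-identifying code: it is nonempty, and the sets of `r`-close codewords
distinguish all sets of at most `ℓ` words (the empty set included). -/
def IsIdentifying {n : ℕ} (r ℓ : ℕ) (C : Finset (Word n)) : Prop :=
  C.Nonempty ∧
    ∀ X Y : Finset (Word n), X.card ≤ ℓ → Y.card ≤ ℓ → X ≠ Y → codeNbhd r C X ≠ codeNbhd r C Y

/-- The smallest cardinality of an `(r, ≤ ℓ)`-identifying code in dimension `n`
(with value `0` if there is no such code). -/
noncomputable def minCard (r ℓ n : ℕ) : ℕ :=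
  sInf {k : ℕ | ∃ C : Finset (Word n), IsIdentifying r ℓ C ∧ C.card = k}

/-- The binary entropy function, in bits; the value at `0` and at `1` is `0`, because
`Real.logb 2 0 = 0`. -/
noncomputable def entropy (x : ℝ) : ℝ :=
  -x * Real.logb 2 x - (1 - x) * Real.logb 2 (1 - x)

end HammingCode

/-! Lower bound: separating `{x}` from `∅` forces the balls around codewords to cover the space, and
for `2 * r ≤ n` a ball has at most `2 ^ (n * entropy (r / n))` points. Upper bound: it suffices that
`C` meets `ball r x \ nbhd r Y` whenever `x ∉ Y` and `|Y| ≤ ℓ`. If each such set has size at least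
`K`, random choice gives a code of size about `2 ^ n * n * (ℓ + 1) / K`. So the point is that `K`
can be a constant fraction of `n.choose r`, divided by nothing depending on `Y`. Flipping `x` on an
`r`-set `S` leaves the ball of `y` exactly when `S` contains less than half of `D = diffSet x y`.
These conditions define a lower set of sets `S`. For a random `S` with density `p`, `ρ < p < 1/2`,
each condition has probability at least `1 - 2 * p` by Markov, and all `ℓ` hold with probability at
least `(1 - 2 * p) ^ ℓ` by FKG. Slice densities of a lower set decrease, and `|S| ≥ r` with
probability tending to 1, so the density in slice `r` is eventually at least `(1 - 2 * p) ^ ℓ / 2`.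
-/

namespace HammingCode

/-! ### Lower sets under product Bernoulli measures. -/

section Bernoulli

variable {α : Type*} [Fintype α]

/-- The weight of `S` under the product of Bernoulli measures with parameter `p`. -/
def bernoulliWeight (p : ℝ) (S : Finset α) : ℝ :=
  p ^ S.card * (1 - p) ^ (Fintype.card α - S.card)

lemma bernoulliWeight_nonneg {p : ℝ} (h0 : 0 ≤ p) (h1 : p ≤ 1) (S : Finset α) :
    0 ≤ bernoulliWeight p S :=
  mul_nonneg (pow_nonneg h0 _) (pow_nonneg (by linarith) _)

lemma sum_bernoulliWeight (p : ℝ) : ∑ S : Finset α, bernoulliWeight p S = 1 := by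
  have h := Fintype.sum_pow_mul_eq_add_pow α p (1 - p)
  simpa [bernoulliWeight] using h

variable [DecidableEq α]

/-- The equality case of the lattice condition in the FKG inequality. -/
lemma bernoulliWeight_mul (p : ℝ) (S T : Finset α) :
    bernoulliWeight p S * bernoulliWeight p T
      = bernoulliWeight p (S ∩ T) * bernoulliWeight p (S ∪ T) := by
  have h1 : S.card + T.card = (S ∩ T).card + (S ∪ T).card :=
    (Finset.card_inter_add_card_union S T).symm
  have hS := S.card_le_univ
  have hT := T.card_le_univ
  have hI := (S ∩ T).card_le_univ
  have hU := (S ∪ T).card_le_univ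
  have h2 : (Fintype.card α - S.card) + (Fintype.card α - T.card)
      = (Fintype.card α - (S ∩ T).card) + (Fintype.card α - (S ∪ T).card) := by omega
  simp only [bernoulliWeight]
  calc _ = p ^ (S.card + T.card)
        * (1 - p) ^ ((Fintype.card α - S.card) + (Fintype.card α - T.card)) := by ring
    _ = _ := by rw [h1, h2]; ring

lemma sum_bernoulliWeight_mem (p : ℝ) (a : α) :
    ∑ S : Finset α, bernoulliWeight p S * (if a ∈ S then 1 else 0) = p := by
  -- Replacing `1 - p` by `0` at the coordinate `a` kills exactly the terms with `a ∉ S` in the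
  -- expansion of the product.
  have h := Finset.prod_add (fun _ : α => p) (fun i => if i = a then 0 else 1 - p) Finset.univ
  have hl : ∏ i : α, (p + if i = a then 0 else 1 - p) = p := by
    have : ∀ i : α, (p + if i = a then 0 else 1 - p) = if i = a then p else 1 := by
      intro i; split_ifs <;> ring
    simp [this]
  rw [hl] at h
  refine Eq.trans ?_ h.symm
  rw [Finset.powerset_univ]
  refine Finset.sum_congr rfl fun S _ => ?_
  rw [bernoulliWeight, Finset.prod_const, mul_assoc]
  congr 1
  by_cases haS : a ∈ S
  · have : ∀ i ∈ Finset.univ \ S, (if i = a then 0 else 1 - p) = 1 - p := by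
      intro i hi
      rw [if_neg]
      rintro rfl
      simp [haS] at hi
    rw [Finset.prod_congr rfl this, Finset.prod_const, Finset.card_univ_sdiff]
    simp [haS]
  · rw [Finset.prod_eq_zero (i := a) (by simp [haS]) (by simp)]
    simp [haS]

/-- Markov's inequality: the mean of `(S ∩ D).card` is `p * D.card`, and the indicator is at least
`1 - 2 * (S ∩ D).card / D.card`. -/
lemma one_sub_two_mul_le_sum_bernoulliWeight {p : ℝ} (h0 : 0 ≤ p) (h1 : p ≤ 1) {D : Finset α}
    (hD : D.Nonempty) :
    1 - 2 * p ≤ ∑ S : Finset α, bernoulliWeight p S *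
      (if 2 * (S ∩ D).card < D.card then 1 else 0) := by
  have hDpos : (0 : ℝ) < D.card := by exact_mod_cast hD.card_pos
  have hmean : ∑ S : Finset α, bernoulliWeight p S * ((S ∩ D).card : ℝ) = p * D.card := by
    have : ∀ S : Finset α, ((S ∩ D).card : ℝ) = ∑ a ∈ D, (if a ∈ S then 1 else 0) := by
      intro S
      rw [Finset.sum_ite_mem]
      simp [Finset.inter_comm]
    simp_rw [this, Finset.mul_sum]
    rw [Finset.sum_comm]
    simp_rw [sum_bernoulliWeight_mem]
    simp [mul_comm]
  refine le_of_mul_le_mul_right ?_ hDpos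
  calc (1 - 2 * p) * D.card
      = ∑ S : Finset α, bernoulliWeight p S * ((D.card : ℝ) - 2 * (S ∩ D).card) := by
        simp_rw [mul_sub, Finset.sum_sub_distrib, mul_left_comm _ (2 : ℝ), ← Finset.mul_sum, hmean,
          ← Finset.sum_mul, sum_bernoulliWeight]
        ring
    _ ≤ ∑ S : Finset α, bernoulliWeight p S *
          (if 2 * (S ∩ D).card < D.card then 1 else 0) * D.card := by
        refine Finset.sum_le_sum fun S _ => ?_
        rw [mul_assoc]
        refine mul_le_mul_of_nonneg_left ?_ (bernoulliWeight_nonneg h0 h1 S)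
        split_ifs with h
        · have : (0 : ℝ) ≤ (S ∩ D).card := by positivity
          linarith
        · have : (D.card : ℝ) ≤ 2 * (S ∩ D).card := by exact_mod_cast not_lt.mp h
          linarith
    _ = _ := by rw [Finset.sum_mul]

/-- Antitone functions are positively correlated under the product of Bernoulli measures. -/
lemma sum_bernoulliWeight_mul_le {p : ℝ} (h0 : 0 ≤ p) (h1 : p ≤ 1) {f g : Finset α → ℝ}
    (hf0 : 0 ≤ f) (hg0 : 0 ≤ g) (hf : Antitone f) (hg : Antitone g) :
    (∑ S, bernoulliWeight p S * f S) * (∑ S, bernoulliWeight p S * g S)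
      ≤ ∑ S, bernoulliWeight p S * (f S * g S) := by
  -- `fkg` concerns monotone functions, so the order is reversed.
  have h := fkg (α := (Finset α)ᵒᵈ) (fun S => f (OrderDual.ofDual S))
    (fun S => g (OrderDual.ofDual S)) (fun S => bernoulliWeight p (OrderDual.ofDual S))
    (fun S => bernoulliWeight_nonneg h0 h1 _) (fun S => hf0 _) (fun S => hg0 _)
    (fun S T hST => hf hST) (fun S T hST => hg hST)
    (fun S T => by
      rw [bernoulliWeight_mul, mul_comm]
      exact le_rfl)
  have e : ∀ F : Finset α → ℝ, ∑ S : (Finset α)ᵒᵈ, F (OrderDual.ofDual S) = ∑ S, F S :=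
    fun F => Equiv.sum_comp OrderDual.ofDual F
  rw [e (fun S => bernoulliWeight p S * f S), e (fun S => bernoulliWeight p S * g S),
    e (bernoulliWeight p), e (fun S => bernoulliWeight p S * (f S * g S)),
    sum_bernoulliWeight, one_mul] at h
  exact h

lemma pow_card_le_sum_bernoulliWeight_prod {p c : ℝ} (h0 : 0 ≤ p) (h1 : p ≤ 1) (hc : 0 ≤ c)
    {κ : Type*} (s : Finset κ) (f : κ → Finset α → ℝ) (hf0 : ∀ i, 0 ≤ f i)
    (hf : ∀ i, Antitone (f i)) (hfc : ∀ i, c ≤ ∑ S, bernoulliWeight p S * f i S) :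
    c ^ s.card ≤ ∑ S, bernoulliWeight p S * ∏ i ∈ s, f i S := by
  classical
  induction s using Finset.induction_on with
  | empty => simp [sum_bernoulliWeight]
  | insert i s his ih =>
    have hprod : Antitone fun S => ∏ j ∈ s, f j S := fun S T hST =>
      Finset.prod_le_prod (fun j _ => hf0 j T) fun j _ => hf j hST
    have hprod0 : 0 ≤ fun S => ∏ j ∈ s, f j S := fun S => Finset.prod_nonneg fun j _ => hf0 j S
    rw [Finset.card_insert_of_notMem his, pow_succ']
    simp_rw [Finset.prod_insert his]
    exact (mul_le_mul (hfc i) ih (pow_nonneg hc _) (hc.trans (hfc i))).trans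
      (sum_bernoulliWeight_mul_le h0 h1 (hf0 i) hprod0 (hf i) hprod)

/-- The family of sets containing less than half of each `D i`. -/
def minorityFamily {κ : Type*} [Fintype κ] (D : κ → Finset α) : Finset (Finset α) :=
  Finset.univ.filter fun S => ∀ i, 2 * (S ∩ D i).card < (D i).card

lemma isLowerSet_minorityFamily {κ : Type*} [Fintype κ] (D : κ → Finset α) :
    IsLowerSet (minorityFamily D : Set (Finset α)) := by
  intro S T hTS hS
  simp only [minorityFamily, Finset.coe_filter, Finset.mem_univ, true_and, Set.mem_ofPred_eq] at hS ⊢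
  intro i
  have : (T ∩ D i).card ≤ (S ∩ D i).card :=
    Finset.card_le_card (Finset.inter_subset_inter_right hTS)
  have := hS i
  omega

/-- The bound depends only on the number of sets `D i`, not on their sizes or overlaps; this makes
the final estimate uniform in `x` and `Y`. -/
lemma pow_le_sum_bernoulliWeight_minorityFamily {p : ℝ} (h0 : 0 ≤ p) (h1 : p ≤ 1 / 2)
    {κ : Type*} [Fintype κ] {D : κ → Finset α} (hD : ∀ i, (D i).Nonempty) :
    (1 - 2 * p) ^ Fintype.card κ ≤ ∑ S ∈ minorityFamily D, bernoulliWeight p S := by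
  have h1' : p ≤ 1 := by linarith
  have h := pow_card_le_sum_bernoulliWeight_prod h0 h1' (by linarith) Finset.univ
    (fun i S => if 2 * (S ∩ D i).card < (D i).card then (1 : ℝ) else 0)
    (fun i S => by dsimp only; split_ifs <;> simp)
    (fun i S T hST => by
      have : (S ∩ D i).card ≤ (T ∩ D i).card :=
        Finset.card_le_card (Finset.inter_subset_inter_right hST)
      dsimp only
      split_ifs
      · rfl
      · omega
      · simp
      · rfl)
    (fun i => one_sub_two_mul_le_sum_bernoulliWeight h0 h1' (hD i))
  rw [Finset.card_univ] at h
  refine h.trans (le_of_eq ?_)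
  rw [minorityFamily, Finset.sum_filter]
  refine Finset.sum_congr rfl fun S _ => ?_
  rw [Finset.prod_boole]
  simp

/-- The slice densities of a lower set decrease. -/
lemma slice_density_le {F : Finset (Finset α)} (hF : IsLowerSet (F : Set (Finset α))) {r k : ℕ}
    (hrk : r ≤ k) :
    ((F.slice k).card : ℝ) / (Fintype.card α).choose k
      ≤ ((F.slice r).card : ℝ) / (Fintype.card α).choose r := by
  induction k, hrk using Nat.le_induction with
  | base => rfl
  | succ k hk ih =>
    refine le_trans ?_ ih
    -- Local LYM, together with the fact that the shadow of one slice of a lower set lies in the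
    -- slice below.
    refine (Finset.local_lubell_yamamoto_meshalkin_inequality_div (Nat.succ_ne_zero k)
      (Finset.sized_slice (𝒜 := F))).trans ?_
    rw [Nat.succ_sub_one]
    refine div_le_div_of_nonneg_right ?_ (by positivity)
    norm_cast
    refine Finset.card_le_card fun T hT => ?_
    obtain ⟨S, hS, hTS, hcard⟩ := Finset.mem_shadow_iff_exists_mem_card_add_one.mp hT
    rw [Finset.mem_slice] at hS ⊢
    exact ⟨hF hTS hS.1, by omega⟩

/-- Chebyshev's inequality for the lower tail of the binomial distribution. -/
lemma binomial_lower_tail {n r : ℕ} {p : ℝ} (h0 : 0 ≤ p) (h1 : p ≤ 1) (hr : (r : ℝ) < n * p) :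
    ∑ k ∈ (Finset.range (n + 1)).filter (· < r), (n.choose k : ℝ) * p ^ k * (1 - p) ^ (n - k)
      ≤ n * p * (1 - p) / (n * p - r) ^ 2 := by
  have hv := congrArg (Polynomial.eval p) (bernsteinPolynomial.variance ℝ n)
  simp only [Polynomial.eval_finsetSum, bernsteinPolynomial] at hv
  simp at hv
  rw [le_div_iff₀ (by nlinarith), ← hv, Finset.sum_mul]
  have hq : 0 ≤ 1 - p := by linarith
  refine (Finset.sum_le_sum fun k hk => ?_).trans
    (Finset.sum_le_sum_of_subset_of_nonneg (Finset.filter_subset _ _) fun k _ _ => by positivity)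
  rw [mul_comm]
  refine mul_le_mul_of_nonneg_right ?_ (by positivity)
  have : (k : ℝ) < r := by exact_mod_cast (Finset.mem_filter.mp hk).2
  nlinarith

/-- Transfers a bound from the Bernoulli measure to the uniform measure on slice `r`. Below `r` the
slice density is bounded by 1 and the mass by Chebyshev; from `r` on the density is at most that of
slice `r`. -/
lemma sum_bernoulliWeight_le {F : Finset (Finset α)} (hF : IsLowerSet (F : Set (Finset α)))
    {r : ℕ} {p : ℝ} (h0 : 0 ≤ p) (h1 : p ≤ 1) (hr : (r : ℝ) < Fintype.card α * p) :
    ∑ S ∈ F, bernoulliWeight p S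
      ≤ Fintype.card α * p * (1 - p) / (Fintype.card α * p - r) ^ 2
        + ((F.slice r).card : ℝ) / (Fintype.card α).choose r := by
  set N := Fintype.card α with hN
  set b : ℕ → ℝ := fun k => (N.choose k : ℝ) * p ^ k * (1 - p) ^ (N - k) with hb
  set d : ℕ → ℝ := fun k => ((F.slice k).card : ℝ) / N.choose k with hd
  have hq : 0 ≤ 1 - p := by linarith
  have hb0 : ∀ k, 0 ≤ b k := fun k => by positivity
  have hd0 : ∀ k, 0 ≤ d k := fun k => by positivity
  have hbsum : ∑ k ∈ Finset.range (N + 1), b k = 1 := by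
    have := (add_pow p (1 - p) N).symm
    rw [add_sub_cancel, one_pow] at this
    rw [← this]
    exact Finset.sum_congr rfl fun k _ => by simp only [hb]; ring
  have hmaps : ∀ S ∈ F, S.card ∈ Finset.range (N + 1) := fun S _ =>
    Finset.mem_range.mpr (Nat.lt_succ_of_le S.card_le_univ)
  have hsum : ∑ S ∈ F, bernoulliWeight p S = ∑ k ∈ Finset.range (N + 1), b k * d k := by
    rw [← Finset.sum_fiberwise_of_maps_to hmaps]
    refine Finset.sum_congr rfl fun k hk => ?_
    have hchoose : (N.choose k : ℝ) ≠ 0 := by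
      have := Nat.choose_pos (Nat.lt_succ_iff.mp (Finset.mem_range.mp hk))
      positivity
    have : ∀ S ∈ F.filter (fun S => S.card = k), bernoulliWeight p S
        = p ^ k * (1 - p) ^ (N - k) := by
      intro S hS
      rw [bernoulliWeight, (Finset.mem_filter.mp hS).2]
    rw [Finset.sum_congr rfl this, Finset.sum_const, nsmul_eq_mul]
    simp only [hb, hd, Finset.slice]
    field_simp
  have hd1 : ∀ k, d k ≤ 1 := by
    intro k
    refine div_le_one_of_le₀ ?_ (by positivity)
    norm_cast
    exact (Finset.sized_slice (𝒜 := F)).card_le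
  rw [hsum, ← Finset.sum_filter_add_sum_filter_not _ (· < r)]
  refine add_le_add ((Finset.sum_le_sum fun k _ => ?_).trans (binomial_lower_tail h0 h1 hr)) ?_
  · exact mul_le_of_le_one_right (hb0 k) (hd1 k)
  · calc _ ≤ ∑ k ∈ (Finset.range (N + 1)).filter (fun k => ¬ k < r), b k * d r :=
          Finset.sum_le_sum fun k hk => mul_le_mul_of_nonneg_left
            (slice_density_le hF (not_lt.mp (Finset.mem_filter.mp hk).2)) (hb0 k)
      _ = (∑ k ∈ (Finset.range (N + 1)).filter (fun k => ¬ k < r), b k) * d r := by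
          rw [Finset.sum_mul]
      _ ≤ 1 * d r := by
          refine mul_le_mul_of_nonneg_right ?_ (hd0 r)
          rw [← hbsum]
          exact Finset.sum_le_sum_of_subset_of_nonneg (Finset.filter_subset _ _)
            fun k _ _ => hb0 k
      _ = d r := one_mul _

end Bernoulli

/-! ### Hitting sets by a union bound. -/

/-- A small hitting set, given as the range of a tuple, for a family of large sets. -/
lemma exists_hitting_tuple {Ω ι : Type*} [Fintype Ω] [DecidableEq Ω] [Fintype ι]
    (A : ι → Finset Ω) {K : ℝ} (hA : ∀ i, K ≤ (A i).card) {t : ℕ}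
    (hΩ : 0 < Fintype.card Ω)
    (ht : (Fintype.card ι : ℝ) < Real.exp (t * K / Fintype.card Ω)) :
    ∃ f : Fin t → Ω, ∀ i, ∃ j, f j ∈ A i := by
  classical
  set N : ℝ := ((Fintype.card Ω : ℕ) : ℝ) with hN
  have hNpos : 0 < N := Nat.cast_pos.mpr hΩ
  by_contra! hcon
  have hcover : (Finset.univ : Finset (Fin t → Ω)) ⊆
      Finset.univ.biUnion fun i => Fintype.piFinset fun _ : Fin t => (A i)ᶜ := by
    intro f _
    obtain ⟨i, hi⟩ := hcon f
    simp only [Finset.mem_biUnion, Finset.mem_univ, true_and, Fintype.mem_piFinset,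
      Finset.mem_compl]
    exact ⟨i, hi⟩
  have hcard := (Finset.card_le_card hcover).trans Finset.card_biUnion_le
  simp only [Finset.card_univ, Fintype.card_pi_const, Fintype.card_piFinset_const] at hcard
  have hcard' : N ^ t ≤ ∑ i : ι, (((A i)ᶜ.card : ℕ) : ℝ) ^ t := by
    rw [hN]; exact_mod_cast hcard
  -- A uniform tuple misses `A i` with probability at most `(1 - K / N) ^ t ≤ exp (-(t * K / N))`.
  have hterm : ∀ i, (((A i)ᶜ.card : ℕ) : ℝ) ^ t ≤ N ^ t * Real.exp (-(t * K / N)) := by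
    intro i
    have h1 : (((A i)ᶜ.card : ℕ) : ℝ) ≤ N * Real.exp (-(K / N)) := by
      have h2 : (((A i)ᶜ.card : ℕ) : ℝ) = N - (A i).card := by
        rw [Finset.card_compl, Nat.cast_sub (A i).card_le_univ]
      have h3 := mul_le_mul_of_nonneg_left (Real.add_one_le_exp (-(K / N))) hNpos.le
      have h4 : N * (-(K / N) + 1) = N - K := by field_simp; ring
      linarith [hA i]
    calc _ ≤ (N * Real.exp (-(K / N))) ^ t := pow_le_pow_left₀ (by positivity) h1 t
      _ = _ := by
        rw [mul_pow, ← Real.exp_nat_mul]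
        congr 2
        ring
  have h5 := hcard'.trans (Finset.sum_le_sum fun i _ => hterm i)
  rw [Finset.sum_const, nsmul_eq_mul, Finset.card_univ] at h5
  have h6 : (Fintype.card ι : ℝ) * (N ^ t * Real.exp (-(t * K / N))) < N ^ t := by
    calc _ < Real.exp (t * K / N) * (N ^ t * Real.exp (-(t * K / N))) :=
          mul_lt_mul_of_pos_right ht (by positivity)
      _ = N ^ t * (Real.exp (t * K / N) * Real.exp (-(t * K / N))) := by ring
      _ = N ^ t := by rw [← Real.exp_add]; simp
  linarith

/-! ### Binomial coefficients and entropy. -/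

/-- The `r`-th term of the expansion of `(r + (n - r)) ^ n` is the largest one. -/
lemma pow_le_succ_mul_choose {n r : ℕ} (hr : r ≤ n) :
    n ^ n ≤ (n + 1) * (n.choose r * (r ^ r * (n - r) ^ (n - r))) := by
  obtain ⟨s, rfl⟩ := Nat.exists_eq_add_of_le hr
  rw [Nat.add_sub_cancel_left]
  set a : ℕ → ℕ := fun k => r ^ k * s ^ (r + s - k) * (r + s).choose k with ha
  -- Cross-multiplied ratio of consecutive terms: they increase up to `k = r` and do not increase
  -- afterwards.
  have hstep : ∀ k, k < r + s →
      a (k + 1) * ((k + 1) * s) = a k * ((r + s - k) * r) := by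
    intro k hk
    have h1 := Nat.choose_succ_right_eq (r + s) k
    have h2 : r + s - k = (r + s - (k + 1)) + 1 := by omega
    simp only [ha]
    calc _ = r ^ (k + 1) * s ^ (r + s - (k + 1) + 1) * ((r + s).choose (k + 1) * (k + 1)) := by
          ring
      _ = _ := by rw [h1, ← h2]; ring
  have hup : ∀ k, r ≤ k → a k ≤ a r := by
    intro k hk
    induction k, hk using Nat.le_induction with
    | base => rfl
    | succ k hk ih =>
      refine le_trans ?_ ih
      rcases Nat.lt_or_ge k (r + s) with hk' | hk'
      · have hs : 0 < s := by omega
        refine Nat.le_of_mul_le_mul_right ?_ (Nat.mul_pos k.succ_pos hs)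
        rw [Nat.succ_eq_add_one, hstep k hk']
        refine Nat.mul_le_mul_left _ ?_
        have : r + s - k ≤ s := by omega
        nlinarith
      · simp [ha, Nat.choose_eq_zero_of_lt (show r + s < k + 1 by omega)]
  have hdown : ∀ j, j ≤ r → a (r - j) ≤ a r := by
    intro j hj
    induction j with
    | zero => rfl
    | succ j ih =>
      refine le_trans ?_ (ih (by omega))
      obtain ⟨k, hk⟩ : ∃ k, r - j = k + 1 := ⟨r - j - 1, by omega⟩
      have hk2 : r - (j + 1) = k := by omega
      rw [hk, hk2]
      refine Nat.le_of_mul_le_mul_right (c := (r + s - k) * r) ?_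
        (Nat.mul_pos (by omega) (by omega))
      rw [← hstep k (by omega)]
      refine Nat.mul_le_mul_left _ ?_
      rw [mul_comm (r + s - k)]
      exact Nat.mul_le_mul (by omega) (by omega)
  have hle : ∀ k, a k ≤ a r := by
    intro k
    rcases le_total r k with h | h
    · exact hup k h
    · have := hdown (r - k) (by omega)
      rwa [Nat.sub_sub_self h] at this
  calc (r + s) ^ (r + s) = ∑ k ∈ Finset.range (r + s + 1), a k := add_pow r s (r + s)
    _ ≤ ∑ k ∈ Finset.range (r + s + 1), a r := Finset.sum_le_sum fun k _ => hle k
    _ = (r + s + 1) * a r := by simp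
    _ = _ := by simp only [ha, Nat.add_sub_cancel_left]; ring

lemma entropy_eq (x : ℝ) : entropy x = Real.binEntropy x / Real.log 2 := by
  rw [entropy, Real.binEntropy, Real.logb, Real.logb, Real.log_inv, Real.log_inv]
  ring

lemma continuous_entropy : Continuous entropy := by
  have : entropy = fun x => Real.binEntropy x / Real.log 2 := funext entropy_eq
  rw [this]
  exact Real.binEntropy_continuous.div_const _

lemma entropy_le_one (x : ℝ) : entropy x ≤ 1 := by
  rw [entropy_eq]
  exact div_le_one_of_le₀ Real.binEntropy_le_log_two (Real.log_nonneg (by norm_num))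

/-- An exact identity, valid also at `r = 0` since `0 ^ 0 = 1` matches `0 * log 0 = 0`. It lets the
counting bounds stay in natural numbers. -/
lemma two_rpow_mul_entropy {n r : ℕ} (hn : 0 < n) (hr : r ≤ n) :
    (2 : ℝ) ^ (n * entropy (r / n)) * ((r ^ r * (n - r) ^ (n - r) : ℕ) : ℝ) = (n : ℝ) ^ n := by
  obtain ⟨s, rfl⟩ := Nat.exists_eq_add_of_le hr
  rw [Nat.add_sub_cancel_left]
  have hn' : (0 : ℝ) < r + s := by exact_mod_cast hn
  have hr0 : (0 : ℝ) < (r : ℝ) ^ r := by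
    rcases Nat.eq_zero_or_pos r with h | h
    · simp [h]
    · positivity
  have hs0 : (0 : ℝ) < (s : ℝ) ^ s := by
    rcases Nat.eq_zero_or_pos s with h | h
    · simp [h]
    · positivity
  have hl2 : Real.log 2 ≠ 0 := (Real.log_pos (by norm_num)).ne'
  push_cast
  apply Real.log_injOn_pos (Set.mem_Ioi.mpr (by positivity)) (Set.mem_Ioi.mpr (by positivity))
  rw [Real.log_mul (by positivity) (by positivity), Real.log_mul hr0.ne' hs0.ne',
    Real.log_rpow (by norm_num), Real.log_pow, Real.log_pow, Real.log_pow, entropy]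
  have h1 : (1 : ℝ) - r / (r + s) = s / (r + s) := by field_simp; ring
  rw [h1]
  have hx : ∀ m : ℕ, ((m : ℝ) / (r + s)) * Real.logb 2 ((m : ℝ) / (r + s))
      = m * (Real.log m - Real.log (r + s)) / ((r + s) * Real.log 2) := by
    intro m
    rcases Nat.eq_zero_or_pos m with h | h
    · simp [h]
    · have : (0 : ℝ) < m := by exact_mod_cast h
      rw [Real.logb, Real.log_div this.ne' hn'.ne']
      field_simp
  rw [neg_mul, hx r, hx s]
  push_cast
  field_simp
  ring

lemma two_rpow_le_choose {n r : ℕ} (hn : 0 < n) (hr : r ≤ n) :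
    (2 : ℝ) ^ (n * entropy (r / n)) ≤ (n + 1) * n.choose r := by
  have h1 : ((n ^ n : ℕ) : ℝ) ≤ (((n + 1) * (n.choose r * (r ^ r * (n - r) ^ (n - r))) : ℕ) : ℝ) := by
    exact_mod_cast pow_le_succ_mul_choose hr
  rw [Nat.cast_pow, ← two_rpow_mul_entropy hn hr, ← mul_assoc (n + 1), Nat.cast_mul _ (_ * _)] at h1
  have hpos : (0 : ℝ) < ((r ^ r * (n - r) ^ (n - r) : ℕ) : ℝ) := by
    have h2 := two_rpow_mul_entropy hn hr
    have h3 : (0 : ℝ) < (n : ℝ) ^ n := by positivity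
    rw [← h2] at h3
    exact pos_of_mul_pos_right h3 (by positivity)
  have := le_of_mul_le_mul_right h1 hpos
  exact_mod_cast this

/-! ### Geometry of the Hamming space and the two code bounds. -/

section Words

variable {n : ℕ}

/-- The set of coordinates in which two words differ. -/
def diffSet (x y : Word n) : Finset (Fin n) :=
  Finset.univ.filter fun j => x j ≠ y j

/-- The word obtained from `x` by changing the coordinates in `S`. -/
def flip (x : Word n) (S : Finset (Fin n)) : Word n :=
  fun j => if j ∈ S then x j + 1 else x j

lemma mem_diffSet {x y : Word n} {j : Fin n} : j ∈ diffSet x y ↔ x j ≠ y j := by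
  simp [diffSet]

lemma diffSet_flip (x : Word n) (S : Finset (Fin n)) : diffSet x (flip x S) = S := by
  ext j
  simp [diffSet, flip]

lemma flip_diffSet (x y : Word n) : flip x (diffSet x y) = y := by
  funext j
  have key : ∀ a b : ZMod 2, (if a ≠ b then a + 1 else a) = b := by decide
  simpa [diffSet, flip] using key (x j) (y j)

lemma hammingDist_eq_card_diffSet (x y : Word n) : hammingDist x y = (diffSet x y).card := rfl

lemma diffSet_flip_right (x y : Word n) (S : Finset (Fin n)) :
    diffSet y (flip x S) = (S \ diffSet x y) ∪ (diffSet x y \ S) := by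
  ext j
  have key : ∀ a b : ZMod 2, ∀ s : Bool, (b ≠ (if s then a + 1 else a)) ↔
      ((s = true ∧ ¬ a ≠ b) ∨ (a ≠ b ∧ ¬ s = true)) := by decide
  have := key (x j) (y j) (decide (j ∈ S))
  simpa [mem_diffSet, flip] using this

/-- Flips inside `diffSet x y` approach `y`, the others move away. With `S.card = r`, the flipped
word is farther than `r` from `y` iff `S` contains less than half of `diffSet x y`. -/
lemma hammingDist_flip_add (x y : Word n) (S : Finset (Fin n)) :
    hammingDist y (flip x S) + 2 * (S ∩ diffSet x y).card = S.card + (diffSet x y).card := by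
  rw [hammingDist_eq_card_diffSet, diffSet_flip_right,
    Finset.card_union_of_disjoint (Finset.disjoint_left.mpr fun j => by simp; tauto)]
  have h1 := Finset.card_sdiff_add_card_inter S (diffSet x y)
  have h2 := Finset.card_sdiff_add_card_inter (diffSet x y) S
  rw [Finset.inter_comm] at h2
  omega

/-- The volume bound for Hamming balls. -/
lemma card_ball_mul_le {r : ℕ} (hr : 2 * r ≤ n) (x : Word n) :
    (ball r x).card * (r ^ r * (n - r) ^ (n - r)) ≤ n ^ n := by
  have hinj : Set.InjOn (diffSet x) (ball r x : Set (Word n)) := by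
    intro y _ z _ h
    rw [← flip_diffSet x y, h, flip_diffSet]
  rw [← Finset.card_image_of_injOn hinj, ← smul_eq_mul, ← Finset.sum_const]
  -- Since `r ≤ n - r`, trading factors `r` for `n - r` when `S.card ≤ r` does not decrease the
  -- term.
  calc _ ≤ ∑ S ∈ (ball r x).image (diffSet x), r ^ S.card * (n - r) ^ (n - S.card) := by
        refine Finset.sum_le_sum fun S hS => ?_
        obtain ⟨y, hy, rfl⟩ := Finset.mem_image.mp hS
        have hy' : (diffSet x y).card ≤ r := (Finset.mem_filter.mp hy).2
        obtain ⟨d, hd⟩ := Nat.exists_eq_add_of_le hy'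
        set k := (diffSet x y).card
        have h1 : n - k = (n - r) + d := by omega
        rw [h1]
        calc r ^ r * (n - r) ^ (n - r) = r ^ k * r ^ d * (n - r) ^ (n - r) := by
              rw [← pow_add, ← hd]
          _ ≤ r ^ k * (n - r) ^ d * (n - r) ^ (n - r) := by
              gcongr
              omega
          _ = _ := by ring
    _ ≤ ∑ S : Finset (Fin n), r ^ S.card * (n - r) ^ (n - S.card) :=
        Finset.sum_le_sum_of_subset (Finset.subset_univ _)
    _ = n ^ n := by
        have h := Fintype.sum_pow_mul_eq_add_pow (Fin n) r (n - r)
        rw [Fintype.card_fin, Nat.add_sub_cancel' (by omega : r ≤ n)] at h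
        exact h

lemma IsIdentifying.two_pow_le {r ℓ : ℕ} (hℓ : 1 ≤ ℓ) (hr : 2 * r ≤ n) {C : Finset (Word n)}
    (hC : IsIdentifying r ℓ C) :
    2 ^ n * (r ^ r * (n - r) ^ (n - r)) ≤ C.card * n ^ n := by
  have hcover : (Finset.univ : Finset (Word n)) ⊆ C.biUnion (ball r) := by
    intro x _
    have h := hC.2 {x} ∅ (by simpa using hℓ) (by simp) (Finset.singleton_ne_empty x)
    obtain ⟨c, hc⟩ : (codeNbhd r C {x}).Nonempty := by
      rw [Finset.nonempty_iff_ne_empty]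
      simpa [codeNbhd, nbhd] using h
    simp only [codeNbhd, nbhd, Finset.singleton_biUnion, Finset.mem_inter] at hc
    refine Finset.mem_biUnion.mpr ⟨c, hc.2, ?_⟩
    have := (Finset.mem_filter.mp hc.1).2
    rw [hammingDist_comm] at this
    exact Finset.mem_filter.mpr ⟨Finset.mem_univ _, this⟩
  have h1 : 2 ^ n ≤ ∑ c ∈ C, (ball r c).card := by
    have := (Finset.card_le_card hcover).trans Finset.card_biUnion_le
    simpa [ZMod.card] using this
  calc _ ≤ (∑ c ∈ C, (ball r c).card) * (r ^ r * (n - r) ^ (n - r)) := Nat.mul_le_mul_right _ h1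
    _ = ∑ c ∈ C, (ball r c).card * (r ^ r * (n - r) ^ (n - r)) := Finset.sum_mul _ _ _
    _ ≤ ∑ c ∈ C, n ^ n := Finset.sum_le_sum fun c _ => card_ball_mul_le hr c
    _ = _ := by simp

lemma card_slice_minorityFamily_le {κ : Type*} [Fintype κ] (r : ℕ) (x : Word n) (y : κ → Word n) :
    ((minorityFamily fun i => diffSet x (y i)).slice r).card
      ≤ (ball r x \ nbhd r (Finset.univ.image y)).card := by
  have hinj : Function.Injective (flip x) := fun S T h => by
    rw [← diffSet_flip x S, h, diffSet_flip]
  rw [← Finset.card_image_of_injective _ hinj]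
  refine Finset.card_le_card fun z hz => ?_
  obtain ⟨S, hS, rfl⟩ := Finset.mem_image.mp hz
  obtain ⟨hSm, hSr⟩ := Finset.mem_slice.mp hS
  have hSm := (Finset.mem_filter.mp hSm).2
  simp only [Finset.mem_sdiff, nbhd, Finset.mem_biUnion, Finset.mem_image, Finset.mem_univ,
    true_and, ball, Finset.mem_filter, not_exists, not_and, not_le]
  refine ⟨by rw [hammingDist_eq_card_diffSet, diffSet_flip]; exact hSr.le, ?_⟩
  rintro _ ⟨i, rfl⟩
  have := hammingDist_flip_add x (y i) S
  have : 2 * (S ∩ diffSet x (y i)).card < (diffSet x (y i)).card := hSm i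
  omega

/-- Pads `Y` to a tuple of length exactly `ℓ` with some word other than `x`. Enlarging `Y` only
makes separation harder. -/
lemma exists_tuple_of_notMem {ℓ : ℕ} (hn : 0 < n) {x : Word n} {Y : Finset (Word n)}
    (hY : Y.card ≤ ℓ) (hx : x ∉ Y) :
    ∃ y : Fin ℓ → Word n, (∀ i, y i ≠ x) ∧ Y ⊆ Finset.univ.image y := by
  have : Nonempty (Fin n) := ⟨⟨0, hn⟩⟩
  obtain ⟨d, hd⟩ := exists_ne x
  refine ⟨fun i => if h : i.1 < Y.card then (Y.equivFin.symm ⟨i, h⟩ : Word n) else d, ?_, ?_⟩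
  · intro i
    dsimp only
    split_ifs with h
    · rintro rfl
      exact hx (Subtype.prop _)
    · exact hd
  · intro z hz
    refine Finset.mem_image.mpr ⟨⟨Y.equivFin ⟨z, hz⟩, by omega⟩, Finset.mem_univ _, ?_⟩
    simp

lemma isIdentifying_of_hitting {r ℓ : ℕ} (hn : 0 < n) {C : Finset (Word n)} (hC : C.Nonempty)
    (h : ∀ (x : Word n) (y : Fin ℓ → Word n), (∀ i, y i ≠ x) →
      ∃ c ∈ C, c ∈ ball r x \ nbhd r (Finset.univ.image y)) :
    IsIdentifying r ℓ C := by
  have key : ∀ X Y : Finset (Word n), Y.card ≤ ℓ → (∃ x ∈ X, x ∉ Y) →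
      codeNbhd r C X ≠ codeNbhd r C Y := by
    rintro X Y hY ⟨x, hxX, hxY⟩ heq
    obtain ⟨y, hy, hYy⟩ := exists_tuple_of_notMem hn hY hxY
    obtain ⟨c, hcC, hc⟩ := h x y hy
    rw [Finset.mem_sdiff] at hc
    have hcX : c ∈ codeNbhd r C X :=
      Finset.mem_inter.mpr ⟨Finset.mem_biUnion.mpr ⟨x, hxX, hc.1⟩, hcC⟩
    rw [heq] at hcX
    exact hc.2 (Finset.biUnion_subset_biUnion_of_subset_left _ hYy (Finset.mem_inter.mp hcX).1)
  refine ⟨hC, fun X Y hX hY hXY => ?_⟩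
  by_cases hsub : X ⊆ Y
  · refine (key Y X hX ?_).symm
    by_contra! hcon
    exact hXY (Finset.Subset.antisymm hsub hcon)
  · exact key X Y hY (Finset.not_subset.mp hsub)

lemma exists_isIdentifying_card_le {r ℓ : ℕ} (hn : 0 < n) {K : ℝ} (hK : 0 < K)
    (hsep : ∀ (x : Word n) (y : Fin ℓ → Word n), (∀ i, y i ≠ x) →
      K ≤ (ball r x \ nbhd r (Finset.univ.image y)).card) :
    ∃ C : Finset (Word n), IsIdentifying r ℓ C ∧
      (C.card : ℝ) ≤ 2 ^ n * (n * (ℓ + 1)) / K + 1 := by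
  set t : ℕ := ⌊(2 : ℝ) ^ n * (n * (ℓ + 1)) / K⌋₊ + 1 with ht
  have hΩ : Fintype.card (Word n) = 2 ^ n := by simp [ZMod.card]
  have hcard : Fintype.card {q : Word n × (Fin ℓ → Word n) // ∀ i, q.2 i ≠ q.1}
      ≤ 2 ^ (n * (ℓ + 1)) := by
    refine (Fintype.card_subtype_le _).trans (le_of_eq ?_)
    rw [Fintype.card_prod, hΩ, Fintype.card_pi_const, hΩ]
    ring
  obtain ⟨f, hf⟩ := exists_hitting_tuple (t := t) (K := K)
    (fun q : {q : Word n × (Fin ℓ → Word n) // ∀ i, q.2 i ≠ q.1} =>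
      ball r q.1.1 \ nbhd r (Finset.univ.image q.1.2)) (fun q => hsep _ _ q.2)
    (by rw [hΩ]; positivity) (by
      have h1 : (2 : ℝ) ^ n * (n * (ℓ + 1)) / K < t := by
        rw [ht]; exact_mod_cast Nat.lt_floor_add_one _
      rw [hΩ]
      have h2 : ((n * (ℓ + 1) : ℕ) : ℝ) < t * K / (2 ^ n : ℕ) := by
        rw [div_lt_iff₀ hK] at h1
        push_cast
        rw [lt_div_iff₀ (by positivity)]
        linarith
      calc _ ≤ (2 : ℝ) ^ (n * (ℓ + 1)) := by exact_mod_cast hcard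
        _ ≤ Real.exp 1 ^ (n * (ℓ + 1)) :=
            pow_le_pow_left₀ (by norm_num) (by linarith [Real.add_one_le_exp 1]) _
        _ = Real.exp ((n * (ℓ + 1) : ℕ) : ℝ) := by rw [← Real.exp_nat_mul, mul_one]
        _ < _ := Real.exp_lt_exp.mpr h2)
  refine ⟨Finset.univ.image f, isIdentifying_of_hitting hn ?_ ?_, ?_⟩
  · exact ⟨f ⟨0, Nat.succ_pos _⟩, Finset.mem_image_of_mem _ (Finset.mem_univ _)⟩
  · intro x y hy
    obtain ⟨j, hj⟩ := hf ⟨(x, y), hy⟩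
    exact ⟨f j, Finset.mem_image_of_mem _ (Finset.mem_univ _), hj⟩
  · have h1 : ((Finset.univ.image f).card : ℝ) ≤ t := by
      have := Finset.card_image_le (s := Finset.univ) (f := f)
      rw [Finset.card_univ, Fintype.card_fin] at this
      exact_mod_cast this
    refine h1.trans ?_
    rw [ht]
    push_cast
    have := Nat.floor_le (show 0 ≤ (2 : ℝ) ^ n * (n * (ℓ + 1)) / K by positivity)
    linarith

end Words

/-! ### Entropy form of the bounds and the limit. -/

lemma exists_isIdentifying_card_le_entropy {n r ℓ : ℕ} {p : ℝ} (hn : 0 < n) (hrn : r ≤ n)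
    (h0 : 0 ≤ p) (h1 : p < 1 / 2) (hr : (r : ℝ) < n * p)
    (htail : n * p * (1 - p) / (n * p - r) ^ 2 ≤ (1 - 2 * p) ^ ℓ / 2) :
    ∃ C : Finset (Word n), IsIdentifying r ℓ C ∧
      (C.card : ℝ) ≤ (2 / (1 - 2 * p) ^ ℓ * (ℓ + 1) + 1) * (n + 1) ^ 2 *
        2 ^ (n * (1 - entropy (r / n))) := by
  set c : ℝ := (1 - 2 * p) ^ ℓ with hc
  have hc0 : 0 < c := pow_pos (by linarith) _
  set E : ℝ := 2 ^ ((n : ℝ) * entropy (r / n)) with hE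
  have hE0 : 0 < E := by positivity
  have hchoose := two_rpow_le_choose hn hrn
  have hcpos : (0 : ℝ) < n.choose r := by exact_mod_cast Nat.choose_pos hrn
  have hn1 : (0 : ℝ) < n + 1 := by positivity
  obtain ⟨C, hC, hcard⟩ := exists_isIdentifying_card_le (r := r) (ℓ := ℓ) hn
    (K := c / 2 * (E / (n + 1))) (by positivity) (by
      intro x y hy
      have hD : ∀ i, (diffSet x (y i)).Nonempty := by
        intro i
        obtain ⟨j, hj⟩ := Function.ne_iff.mp (hy i).symm
        exact ⟨j, mem_diffSet.mpr hj⟩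
      have h2 := (pow_le_sum_bernoulliWeight_minorityFamily h0 h1.le hD).trans
        (sum_bernoulliWeight_le (isLowerSet_minorityFamily _) (r := r) h0 (by linarith)
          (by rwa [Fintype.card_fin]))
      rw [Fintype.card_fin, Fintype.card_fin, ← hc] at h2
      have h3 : c / 2 ≤ (((minorityFamily fun i => diffSet x (y i)).slice r).card : ℝ)
          / n.choose r := by linarith
      rw [le_div_iff₀ hcpos] at h3
      have h4 : (((minorityFamily fun i => diffSet x (y i)).slice r).card : ℝ)
          ≤ (ball r x \ nbhd r (Finset.univ.image y)).card := by
        exact_mod_cast card_slice_minorityFamily_le r x y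
      refine le_trans ?_ (h3.trans h4)
      refine mul_le_mul_of_nonneg_left ?_ (by positivity)
      rw [div_le_iff₀ hn1]
      linarith)
  refine ⟨C, hC, hcard.trans ?_⟩
  have hpow : (2 : ℝ) ^ (n * (1 - entropy (r / n))) = 2 ^ n / E := by
    rw [mul_sub, mul_one, Real.rpow_sub (by norm_num), Real.rpow_natCast]
  rw [hpow]
  have hone : 1 ≤ (2 : ℝ) ^ n / E := by
    rw [← hpow]
    exact Real.one_le_rpow (by norm_num)
      (mul_nonneg (by positivity) (by linarith [entropy_le_one (r / n)]))
  have h5 : (2 : ℝ) ^ n * (n * (ℓ + 1)) / (c / 2 * (E / (n + 1)))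
      = 2 / c * (ℓ + 1) * (n * (n + 1)) * (2 ^ n / E) := by
    field_simp
  rw [h5, add_mul, add_mul]
  refine add_le_add ?_ ?_
  · gcongr
    nlinarith
  · rw [one_mul]
    have : (1 : ℝ) ≤ (n + 1) ^ 2 := by nlinarith [(Nat.cast_nonneg n : (0 : ℝ) ≤ n)]
    nlinarith

lemma IsIdentifying.two_rpow_le_card {n r ℓ : ℕ} (hn : 0 < n) (hℓ : 1 ≤ ℓ) (hr : 2 * r ≤ n)
    {C : Finset (Word n)} (hC : IsIdentifying r ℓ C) :
    (2 : ℝ) ^ (n * (1 - entropy (r / n))) ≤ C.card := by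
  have h1 : ((2 ^ n * (r ^ r * (n - r) ^ (n - r)) : ℕ) : ℝ) ≤ ((C.card * n ^ n : ℕ) : ℝ) := by
    exact_mod_cast hC.two_pow_le hℓ hr
  have h2 := two_rpow_mul_entropy hn (by omega : r ≤ n)
  rw [Nat.cast_mul (2 ^ n), Nat.cast_mul C.card, Nat.cast_pow n, ← h2, ← mul_assoc] at h1
  have h3 : (0 : ℝ) < ((r ^ r * (n - r) ^ (n - r) : ℕ) : ℝ) := by
    have h3 : (0 : ℝ) < (n : ℝ) ^ n := by positivity
    rw [← h2] at h3
    exact pos_of_mul_pos_right h3 (by positivity)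
  have h4 := le_of_mul_le_mul_right h1 h3
  rw [mul_sub, mul_one, Real.rpow_sub (by norm_num), Real.rpow_natCast,
    div_le_iff₀ (by positivity)]
  exact_mod_cast h4

lemma exists_isIdentifying_card_eq_minCard {n r ℓ : ℕ}
    (h : ∃ C : Finset (Word n), IsIdentifying r ℓ C) :
    ∃ C : Finset (Word n), IsIdentifying r ℓ C ∧ C.card = minCard r ℓ n := by
  obtain ⟨C, hC⟩ := h
  exact Nat.sInf_mem (s := {k : ℕ | ∃ C : Finset (Word n), IsIdentifying r ℓ C ∧ C.card = k})
    ⟨C.card, C, hC, rfl⟩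

lemma tendsto_logb_succ_div : Tendsto (fun n : ℕ => Real.logb 2 ((n : ℝ) + 1) / n) atTop (𝓝 0) := by
  have h := (Real.tendsto_pow_log_div_mul_add_atTop 1 (-1) 1 one_ne_zero).comp
    (tendsto_atTop_add_const_right _ (1 : ℝ) tendsto_natCast_atTop_atTop)
  have h2 := h.div_const (Real.log 2)
  rw [zero_div] at h2
  refine h2.congr fun n => ?_
  simp only [Function.comp, pow_one, one_mul, add_neg_cancel_right, Real.logb]
  ring

end HammingCode

open HammingCode in
theorem theorem1 (ℓ : ℕ) (hℓ : 1 ≤ ℓ) (ρ : ℝ) (hρ : ρ ∈ Set.Ico (0 : ℝ) (1 / 2))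
    (r : ℕ → ℕ) (hr : Tendsto (fun n : ℕ => (r n : ℝ) / (n : ℝ)) atTop (𝓝 ρ)) :
    (∀ᶠ n : ℕ in atTop, ∃ C : Finset (HammingCode.Word n), HammingCode.IsIdentifying (r n) ℓ C) ∧
      Tendsto (fun n : ℕ => 1 / (n : ℝ) * Real.logb 2 (HammingCode.minCard (r n) ℓ n : ℝ))
        atTop (𝓝 (1 - HammingCode.entropy ρ)) := by
  obtain ⟨hρ0, hρ1⟩ := hρ
  -- Eventually `r n < n * p'`, so `n * p - r n` exceeds `n * (p - p')` and the Chebyshev term is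
  -- `O(1 / n)`.
  obtain ⟨p', hp'ρ, hp'1⟩ := exists_between hρ1
  obtain ⟨p, hp'p, hp1⟩ := exists_between hp'1
  have hp0 : 0 < p := by linarith
  set c : ℝ := (1 - 2 * p) ^ ℓ with hc
  have hc0 : 0 < c := pow_pos (by linarith) _
  set A : ℝ := 2 / c * (ℓ + 1) + 1 with hA
  have hA0 : 0 < A := by positivity
  have htail : Tendsto (fun n : ℕ => p * (1 - p) / (p - p') ^ 2 / (n : ℝ)) atTop (𝓝 0) :=
    tendsto_const_div_atTop_nhds_zero_nat _
  have hmain : ∀ᶠ n : ℕ in atTop, 0 < n ∧ 2 * r n ≤ n ∧ ∃ C : Finset (Word n),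
      IsIdentifying (r n) ℓ C ∧
        (C.card : ℝ) ≤ A * (n + 1) ^ 2 * 2 ^ (n * (1 - entropy (r n / n))) := by
    filter_upwards [eventually_gt_atTop 0, hr.eventually_lt_const hp'ρ,
      htail.eventually_lt_const (half_pos hc0)] with n hn hrn hnt
    have hn' : (0 : ℝ) < n := by exact_mod_cast hn
    rw [div_lt_iff₀ hn'] at hrn
    have h2r : 2 * r n ≤ n := by
      have : (2 * r n : ℝ) ≤ n := by nlinarith
      exact_mod_cast this
    have hlt : (n : ℝ) * (p - p') < n * p - r n := by linarith
    have hpp : 0 < (n : ℝ) * (p - p') := mul_pos hn' (by linarith)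
    refine ⟨hn, h2r, exists_isIdentifying_card_le_entropy hn (by omega) hp0.le hp1
      (by linarith) ?_⟩
    refine le_trans ?_ hnt.le
    have hne : p - p' ≠ 0 := (sub_pos.mpr hp'p).ne'
    calc (n : ℝ) * p * (1 - p) / (n * p - r n) ^ 2
        ≤ n * p * (1 - p) / (n * (p - p')) ^ 2 := by
          have : 0 ≤ 1 - p := by linarith
          gcongr
      _ = _ := by field_simp
  have hent : Tendsto (fun n : ℕ => 1 - entropy (r n / n)) atTop (𝓝 (1 - entropy ρ)) :=
    ((continuous_entropy.tendsto ρ).comp hr).const_sub 1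
  refine ⟨hmain.mono fun n ⟨_, _, C, hC, _⟩ => ⟨C, hC⟩, ?_⟩
  have hupper : Tendsto (fun n : ℕ => Real.logb 2 A / n + 2 * (Real.logb 2 ((n : ℝ) + 1) / n)
      + (1 - entropy (r n / n))) atTop (𝓝 (1 - entropy ρ)) := by
    simpa using ((tendsto_const_div_atTop_nhds_zero_nat (Real.logb 2 A)).add
      (tendsto_logb_succ_div.const_mul 2)).add hent
  refine tendsto_of_tendsto_of_tendsto_of_le_of_le' hent hupper ?_ ?_
  · filter_upwards [hmain] with n ⟨hn, h2r, C, hC, _⟩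
    have hn' : (0 : ℝ) < n := by exact_mod_cast hn
    obtain ⟨C₀, hC₀, hcard₀⟩ := exists_isIdentifying_card_eq_minCard ⟨C, hC⟩
    have h1 := hC₀.two_rpow_le_card hn hℓ h2r
    rw [hcard₀] at h1
    have h2 := Real.logb_le_logb_of_le (b := 2) (by norm_num) (by positivity) h1
    rw [Real.logb_rpow (by norm_num) (by norm_num)] at h2
    rw [one_div, ← div_eq_inv_mul, le_div_iff₀ hn']
    linarith
  · filter_upwards [hmain] with n ⟨hn, h2r, C, hC, hcard⟩
    have hn' : (0 : ℝ) < n := by exact_mod_cast hn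
    have hmin : minCard (r n) ℓ n ≤ C.card := Nat.sInf_le ⟨C, hC, rfl⟩
    -- Excludes the default value `0` of `minCard`; codes are nonempty by definition.
    have hpos : (0 : ℝ) < minCard (r n) ℓ n := by
      obtain ⟨C₀, hC₀, hcard₀⟩ := exists_isIdentifying_card_eq_minCard ⟨C, hC⟩
      rw [← hcard₀]
      exact_mod_cast hC₀.1.card_pos
    have h1 : (minCard (r n) ℓ n : ℝ) ≤ A * (n + 1) ^ 2 * 2 ^ (n * (1 - entropy (r n / n))) :=
      le_trans (by exact_mod_cast hmin) hcard
    have h2 := Real.logb_le_logb_of_le (b := 2) (by norm_num) hpos h1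
    rw [Real.logb_mul (by positivity) (by positivity), Real.logb_mul hA0.ne' (by positivity),
      Real.logb_pow, Real.logb_rpow (by norm_num) (by norm_num)] at h2
    rw [one_div, ← div_eq_inv_mul, div_le_iff₀ hn']
    refine h2.trans (le_of_eq ?_)
    push_cast
    field_simp
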